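/- Let $G$ be a connected semisimple linear algebraic group over $\mathbb{C}$, i.e. a Zariski-closed, connected subgroup of some $GL_n(\mathbb{C})$ whose only connected, solvable, closed normal subgroup is trivial. Let $\mathfrak{g}$ be its Lie algebra, on which $G$ acts by the adjoint representation, and call the orbits $\{\mathrm{Ad}_g(x) : g \in G\}$, $x\in\mathfrak{g}$, adjoint orbits. An adjoint orbit is called nilpotent if it contains an element $x$ for which $\mathrm{ad}_x : \mathfrak{g}\to\mathfrak{g}$ is a nilpotent endomorphism. The set of all adjoint orbits is partially ordered by the closure order: $\mathcal{O}_1 \le \mathcal{O}_2$ if and only if $\mathcal{O}_1 \subseteq \overline{\mathcal{O}_2}$, the closure being taken in the Zariski topology of $\mathfrak{g}$. Call a subset $Q$ of a poset a connected component if it is maximal (under inclusion) among the subsets with the following property: for all $p, q \in Q$ there are $r_1,\dots,r_k \in Q$ with $r_1 = p$, $r_k = q$ and, for each $j \in\{1,\dots,k-1\}$, $r_j \le r_{j+1}$ or $r_j \ge r_{j+1}$. Then the nilpotent orbits form a connected component in the poset of adjoint orbits. In particular, $\{0\}$ is a nilpotent orbit, every nilpotent orbit is joined to $\{0\}$ by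 such a finite sequence of comparisons among nilpotent orbits, and every adjoint orbit $\Theta$ that satisfies $\Theta \le \mathcal{O}$ or $\mathcal{O} \le \Theta$ for some nilpotent orbit $\mathcal{O}$ is nilpotent. -/

import Mathlib

open Topology

noncomputable section

namespace AdjointOrbits

attribute [local instance] LieRing.ofAssociativeRing

/-- The algebra `ℂ[V]` of polynomial functions on a complex vector space `V`: the algebra of
functions generated by the linear functionals. -/
def polynomialFunctions (V : Type*) [AddCommGroup V] [Module ℂ V] : Subalgebra ℂ (V → ℂ) :=
  Algebra.adjoin ℂ (Set.range fun φ : Module.Dual ℂ V => (φ : V → ℂ))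

theorem linear_mem_polynomialFunctions {V : Type*} [AddCommGroup V] [Module ℂ V]
    (φ : Module.Dual ℂ V) : (φ : V → ℂ) ∈ polynomialFunctions V :=
  Algebra.subset_adjoin ⟨φ, rfl⟩

theorem comp_mem_polynomialFunctions {V W : Type*} [AddCommGroup V] [Module ℂ V]
    [AddCommGroup W] [Module ℂ W] {F : V → W}
    (hF : ∀ φ : Module.Dual ℂ W, (fun v => φ (F v)) ∈ polynomialFunctions V)
    {f : W → ℂ} (hf : f ∈ polynomialFunctions W) :
    (fun v => f (F v)) ∈ polynomialFunctions V := by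
  induction hf using Algebra.adjoin_induction with
  | mem x hx => obtain ⟨φ, rfl⟩ := hx; exact hF φ
  | algebraMap r => exact (polynomialFunctions V).algebraMap_mem r
  | add x y _ _ hx hy => exact (polynomialFunctions V).add_mem hx hy
  | mul x y _ _ hx hy => exact (polynomialFunctions V).mul_mem hx hy

theorem comp_linear_mem_polynomialFunctions {V W : Type*} [AddCommGroup V] [Module ℂ V]
    [AddCommGroup W] [Module ℂ W] (L : V →ₗ[ℂ] W)
    {f : W → ℂ} (hf : f ∈ polynomialFunctions W) :
    (fun v => f (L v)) ∈ polynomialFunctions V :=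
  comp_mem_polynomialFunctions (F := L)
    (fun φ => linear_mem_polynomialFunctions (φ.comp L)) hf

/-- The Zariski topology on a complex vector space `V`: the closed sets are the common zero loci
of sets of polynomial functions. -/
abbrev zariskiTopology (V : Type*) [AddCommGroup V] [Module ℂ V] : TopologicalSpace V :=
  TopologicalSpace.ofClosed
    {S | ∃ F : Set (V → ℂ), F ⊆ polynomialFunctions V ∧ S = {v | ∀ f ∈ F, f v = 0}}
    ⟨{1}, by simp [(polynomialFunctions V).one_mem], by ext; simp⟩
    (by
      intro A hA
      refine ⟨{f | f ∈ polynomialFunctions V ∧ ∃ S ∈ A, ∀ v ∈ S, f v = 0}, fun f hf => hf.1, ?_⟩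
      ext v
      simp only [Set.mem_sInter, Set.mem_ofPred_eq]
      constructor
      · rintro h f ⟨-, S, hS, hf⟩
        exact hf v (h S hS)
      · intro h S hS
        obtain ⟨F, hF, rfl⟩ := hA hS
        exact fun f hf => h f ⟨hF hf, _, hS, fun v hv => hv f hf⟩)
    (by
      rintro _ ⟨F, hF, rfl⟩ _ ⟨F', hF', rfl⟩
      refine ⟨{h | ∃ f ∈ F, ∃ f' ∈ F', h = f * f'}, ?_, ?_⟩
      · rintro _ ⟨f, hf, f', hf', rfl⟩
        exact (polynomialFunctions V).mul_mem (hF hf) (hF' hf')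
      · ext v
        simp only [Set.mem_union, Set.mem_ofPred_eq]
        constructor
        · rintro (h | h) _ ⟨f, hf, f', hf', rfl⟩
          · simp [h f hf]
          · simp [h f' hf']
        · intro h
          by_contra! hc
          obtain ⟨⟨f, hf, hfv⟩, f', hf', hfv'⟩ := hc
          exact mul_ne_zero hfv hfv' (h _ ⟨f, hf, f', hf', rfl⟩))

theorem isClosed_zariski_iff {V : Type*} [AddCommGroup V] [Module ℂ V] {S : Set V} :
    IsClosed[zariskiTopology V] S ↔
      ∃ F : Set (V → ℂ), F ⊆ polynomialFunctions V ∧ S = {v | ∀ f ∈ F, f v = 0} := by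
  rw [← @isOpen_compl_iff _ _ (zariskiTopology V)]
  change Sᶜᶜ ∈ _ ↔ _
  rw [compl_compl]
  rfl

theorem mem_closure_zariski_iff {V : Type*} [AddCommGroup V] [Module ℂ V] {S : Set V} {v : V} :
    v ∈ closure[zariskiTopology V] S ↔
      ∀ f ∈ polynomialFunctions V, (∀ s ∈ S, f s = 0) → f v = 0 := by
  let _ := zariskiTopology V
  constructor
  · intro hv f hf hS
    have hc : IsClosed {v | ∀ g ∈ ({f} : Set (V → ℂ)), g v = 0} :=
      isClosed_zariski_iff.2 ⟨{f}, by simpa using hf, rfl⟩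
    have := closure_minimal (s := S) (fun s hs => by simpa using hS s hs) hc hv
    simpa using this
  · intro h
    obtain ⟨F, hF, hFS⟩ := isClosed_zariski_iff.1 (isClosed_closure (s := S))
    have hv : v ∈ {v | ∀ f ∈ F, f v = 0} := fun f hf => h f (hF hf) fun s hs => by
      have : s ∈ closure S := subset_closure hs
      rw [hFS] at this
      exact this f hf
    rwa [← hFS] at hv

/-- The Zariski topology on `GL_n(ℂ)`, as a subspace of the space of all matrices. -/
abbrev zariskiTopologyGL (n : ℕ) : TopologicalSpace (GL (Fin n) ℂ) :=
  (zariskiTopology (Matrix (Fin n) (Fin n) ℂ)).induced fun g => (g : Matrix (Fin n) (Fin n) ℂ)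

/-- A linear algebraic group over `ℂ`: a Zariski-closed subgroup of some `GL_n(ℂ)`. -/
structure LinearAlgebraicGroup (n : ℕ) extends Subgroup (GL (Fin n) ℂ) where
  isClosed_carrier : IsClosed[zariskiTopologyGL n] carrier

variable {n : ℕ}

theorem LinearAlgebraicGroup.mem_of_forall (G : LinearAlgebraicGroup n) {g : GL (Fin n) ℂ}
    (hg : ∀ f ∈ polynomialFunctions (Matrix (Fin n) (Fin n) ℂ),
      (∀ h ∈ G.toSubgroup, f (h : Matrix (Fin n) (Fin n) ℂ) = 0) →
        f (g : Matrix (Fin n) (Fin n) ℂ) = 0) : g ∈ G.toSubgroup := by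
  obtain ⟨T, hT, hTG⟩ := (@isClosed_induced_iff _ _
    (zariskiTopology (Matrix (Fin n) (Fin n) ℂ)) _ _).1 G.isClosed_carrier
  obtain ⟨F, hF, rfl⟩ := isClosed_zariski_iff.1 hT
  change g ∈ G.carrier
  rw [← hTG]
  refine fun f hf => hg f (hF hf) fun h hh => ?_
  change h ∈ G.carrier at hh
  rw [← hTG] at hh
  exact hh f hf

/-- Polynomials in the linear functionals, as functions on `V`. -/
def evalPoly (V : Type*) [AddCommGroup V] [Module ℂ V] :
    MvPolynomial (Module.Dual ℂ V) ℂ →ₐ[ℂ] (V → ℂ) :=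
  MvPolynomial.aeval fun φ v => φ v

theorem exists_evalPoly_eq {V : Type*} [AddCommGroup V] [Module ℂ V] {f : V → ℂ}
    (hf : f ∈ polynomialFunctions V) : ∃ p, evalPoly V p = f := by
  rw [polynomialFunctions, Algebra.adjoin_range_eq_range_aeval] at hf
  exact hf

theorem evalPoly_mem {V : Type*} [AddCommGroup V] [Module ℂ V]
    (p : MvPolynomial (Module.Dual ℂ V) ℂ) : evalPoly V p ∈ polynomialFunctions V := by
  rw [polynomialFunctions, Algebra.adjoin_range_eq_range_aeval]
  exact ⟨p, rfl⟩

/-- The derivation of polynomials along the linear vector field `v ↦ L v`. -/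
def fieldDerivation {V : Type*} [AddCommGroup V] [Module ℂ V] (L : V →ₗ[ℂ] V) :
    Derivation ℂ (MvPolynomial (Module.Dual ℂ V) ℂ) (MvPolynomial (Module.Dual ℂ V) ℂ) :=
  MvPolynomial.mkDerivation ℂ fun φ => MvPolynomial.X (φ.comp L)

theorem hasLineDerivAt_evalPoly {V : Type*} [AddCommGroup V] [Module ℂ V] (L : V →ₗ[ℂ] V)
    (p : MvPolynomial (Module.Dual ℂ V) ℂ) (v : V) :
    HasLineDerivAt ℂ (evalPoly V p) (evalPoly V (fieldDerivation L p) v) v (L v) := by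
  induction p using MvPolynomial.induction_on with
  | C a => simpa [evalPoly, HasLineDerivAt] using hasDerivAt_const (0 : ℂ) a
  | add p q hp hq =>
    simp only [map_add]
    exact HasDerivAt.add hp hq
  | mul_X p φ hp =>
    have h2 : HasDerivAt (fun t : ℂ => φ (v + t • L v)) (φ (L v)) 0 := by
      simpa using ((hasDerivAt_id (0 : ℂ)).mul_const (φ (L v))).const_add (φ v)
    have h := HasDerivAt.mul hp h2
    have e : evalPoly V (fieldDerivation L (p * MvPolynomial.X φ)) v
        = evalPoly V (fieldDerivation L p) v * φ (v + (0 : ℂ) • L v)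
          + evalPoly V p (v + (0 : ℂ) • L v) * φ (L v) := by
      rw [Derivation.leibniz]
      simp [evalPoly, fieldDerivation, MvPolynomial.mkDerivation_X, mul_comm, add_comm]
    have e' : evalPoly V (p * MvPolynomial.X φ) = evalPoly V p * φ := by
      simp [evalPoly]
    rw [e, e']
    exact h

theorem fieldDerivation_comm {V : Type*} [AddCommGroup V] [Module ℂ V] (L M : V →ₗ[ℂ] V)
    (p : MvPolynomial (Module.Dual ℂ V) ℂ) (v : V) :
    evalPoly V (fieldDerivation L (fieldDerivation M p)) v
      - evalPoly V (fieldDerivation M (fieldDerivation L p)) v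
      = evalPoly V (fieldDerivation (M.comp L - L.comp M) p) v := by
  induction p using MvPolynomial.induction_on with
  | C a => simp [fieldDerivation]
  | add p q hp hq => simp only [map_add, Pi.add_apply, ← hp, ← hq]; ring
  | mul_X p φ hp =>
    simp only [Derivation.leibniz, map_add, map_mul, smul_eq_mul, Pi.add_apply, Pi.mul_apply,
      ← hp]
    simp [fieldDerivation, MvPolynomial.mkDerivation_X, evalPoly]
    ring

theorem fieldDerivation_add {V : Type*} [AddCommGroup V] [Module ℂ V] (L M : V →ₗ[ℂ] V)
    (p : MvPolynomial (Module.Dual ℂ V) ℂ) :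
    evalPoly V (fieldDerivation (L + M) p)
      = evalPoly V (fieldDerivation L p) + evalPoly V (fieldDerivation M p) := by
  induction p using MvPolynomial.induction_on with
  | C a => simp [fieldDerivation]
  | add p q hp hq => simp only [map_add, hp, hq]; ring
  | mul_X p φ hp =>
    simp only [Derivation.leibniz, map_add, map_mul, smul_eq_mul, hp]
    have : evalPoly V (fieldDerivation (L + M) (MvPolynomial.X φ))
        = evalPoly V (fieldDerivation L (MvPolynomial.X φ))
          + evalPoly V (fieldDerivation M (MvPolynomial.X φ)) := by
      ext v
      simp [fieldDerivation, MvPolynomial.mkDerivation_X, evalPoly]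
    rw [this]
    ring

theorem fieldDerivation_smul {V : Type*} [AddCommGroup V] [Module ℂ V] (c : ℂ) (L : V →ₗ[ℂ] V)
    (p : MvPolynomial (Module.Dual ℂ V) ℂ) :
    evalPoly V (fieldDerivation (c • L) p) = c • evalPoly V (fieldDerivation L p) := by
  induction p using MvPolynomial.induction_on with
  | C a => simp [fieldDerivation]
  | add p q hp hq => simp only [map_add, hp, hq, smul_add]
  | mul_X p φ hp =>
    simp only [Derivation.leibniz, map_add, map_mul, smul_eq_mul, hp]
    have : evalPoly V (fieldDerivation (c • L) (MvPolynomial.X φ))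
        = c • evalPoly V (fieldDerivation L (MvPolynomial.X φ)) := by
      ext v
      simp [fieldDerivation, MvPolynomial.mkDerivation_X, evalPoly]
    rw [this, mul_smul_comm, mul_smul_comm, smul_add]

theorem lineDeriv_evalPoly_one (X : Matrix (Fin n) (Fin n) ℂ)
    (p : MvPolynomial (Module.Dual ℂ (Matrix (Fin n) (Fin n) ℂ)) ℂ) :
    lineDeriv ℂ (evalPoly _ p) 1 X = evalPoly _ (fieldDerivation (LinearMap.mulRight ℂ X) p) 1 := by
  have := (hasLineDerivAt_evalPoly (LinearMap.mulRight ℂ X) p 1).lineDeriv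
  simpa using this

theorem fieldDerivation_vanish (G : LinearAlgebraicGroup n) {X : Matrix (Fin n) (Fin n) ℂ}
    (hX : ∀ f ∈ polynomialFunctions (Matrix (Fin n) (Fin n) ℂ),
      (∀ g ∈ G.toSubgroup, f (g : Matrix (Fin n) (Fin n) ℂ) = 0) → lineDeriv ℂ f 1 X = 0)
    (p : MvPolynomial (Module.Dual ℂ (Matrix (Fin n) (Fin n) ℂ)) ℂ)
    (hp : ∀ g ∈ G.toSubgroup, evalPoly _ p (g : Matrix (Fin n) (Fin n) ℂ) = 0)
    (g : GL (Fin n) ℂ) (hg : g ∈ G.toSubgroup) :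
    evalPoly _ (fieldDerivation (LinearMap.mulRight ℂ X) p) (g : Matrix (Fin n) (Fin n) ℂ) = 0 := by
  have h := hX (fun A => evalPoly _ p ((g : Matrix (Fin n) (Fin n) ℂ) * A))
    (comp_linear_mem_polynomialFunctions (LinearMap.mulLeft ℂ (g : Matrix (Fin n) (Fin n) ℂ))
      (evalPoly_mem p))
    (fun k hk => by simpa using hp (g * k) (G.toSubgroup.mul_mem hg hk))
  have h2 := (hasLineDerivAt_evalPoly (LinearMap.mulRight ℂ X) p
    (g : Matrix (Fin n) (Fin n) ℂ)).lineDeriv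
  rw [← h2, ← h]
  simp [lineDeriv, mul_add]

theorem lie_tangent (G : LinearAlgebraicGroup n) {X Y : Matrix (Fin n) (Fin n) ℂ}
    (hX : ∀ f ∈ polynomialFunctions (Matrix (Fin n) (Fin n) ℂ),
      (∀ g ∈ G.toSubgroup, f (g : Matrix (Fin n) (Fin n) ℂ) = 0) → lineDeriv ℂ f 1 X = 0)
    (hY : ∀ f ∈ polynomialFunctions (Matrix (Fin n) (Fin n) ℂ),
      (∀ g ∈ G.toSubgroup, f (g : Matrix (Fin n) (Fin n) ℂ) = 0) → lineDeriv ℂ f 1 Y = 0) :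
    ∀ f ∈ polynomialFunctions (Matrix (Fin n) (Fin n) ℂ),
      (∀ g ∈ G.toSubgroup, f (g : Matrix (Fin n) (Fin n) ℂ) = 0) → lineDeriv ℂ f 1 ⁅X, Y⁆ = 0 := by
  intro f hf hG
  obtain ⟨p, rfl⟩ := exists_evalPoly_eq hf
  have h1 := hX _ (evalPoly_mem (fieldDerivation (LinearMap.mulRight ℂ Y) p))
    (fieldDerivation_vanish G hY p hG)
  have h2 := hY _ (evalPoly_mem (fieldDerivation (LinearMap.mulRight ℂ X) p))
    (fieldDerivation_vanish G hX p hG)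
  rw [lineDeriv_evalPoly_one] at h1 h2 ⊢
  have h3 := fieldDerivation_comm (LinearMap.mulRight ℂ X) (LinearMap.mulRight ℂ Y) p 1
  rw [h1, h2, sub_zero] at h3
  have e : LinearMap.mulRight ℂ ⁅X, Y⁆ = (LinearMap.mulRight ℂ Y).comp (LinearMap.mulRight ℂ X)
      - (LinearMap.mulRight ℂ X).comp (LinearMap.mulRight ℂ Y) := by
    refine LinearMap.ext fun A => ?_
    simp only [LinearMap.mulRight_apply, LinearMap.sub_apply, LinearMap.comp_apply,
      LieRing.of_associative_ring_bracket, mul_sub, mul_assoc]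
  rw [e, ← h3]

/-- The Lie algebra `𝔤` of `G ⊆ GL_n(ℂ)`, realised as the Zariski tangent space at the identity:
the matrices `X` along which the differential at `1` of every polynomial function vanishing on `G`
is zero, with the commutator of matrices as bracket. -/
def LinearAlgebraicGroup.lieAlgebra (G : LinearAlgebraicGroup n) :
    LieSubalgebra ℂ (Matrix (Fin n) (Fin n) ℂ) where
  carrier := {X | ∀ f ∈ polynomialFunctions (Matrix (Fin n) (Fin n) ℂ),
    (∀ g ∈ G.toSubgroup, f (g : Matrix (Fin n) (Fin n) ℂ) = 0) → lineDeriv ℂ f 1 X = 0}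
  zero_mem' := fun f _ _ => lineDeriv_zero
  add_mem' := by
    intro X Y hX hY f hf hG
    obtain ⟨p, rfl⟩ := exists_evalPoly_eq hf
    have hX := hX _ hf hG
    have hY := hY _ hf hG
    rw [lineDeriv_evalPoly_one] at *
    have e : LinearMap.mulRight ℂ (X + Y) = LinearMap.mulRight ℂ X + LinearMap.mulRight ℂ Y := by
      ext1 A
      simp [mul_add]
    rw [e, fieldDerivation_add, Pi.add_apply, hX, hY, add_zero]
  smul_mem' := by
    intro c X hX f hf hG
    obtain ⟨p, rfl⟩ := exists_evalPoly_eq hf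
    have hX := hX _ hf hG
    rw [lineDeriv_evalPoly_one] at *
    have e : LinearMap.mulRight ℂ (c • X) = c • LinearMap.mulRight ℂ X := by
      ext1 A
      simp
    rw [e, fieldDerivation_smul, Pi.smul_apply, hX, smul_zero]
  lie_mem' := fun hX hY => lie_tangent G hX hY

theorem conj_mem_lieAlgebra (G : LinearAlgebraicGroup n) {g : GL (Fin n) ℂ}
    (hg : g ∈ G.toSubgroup) {X : Matrix (Fin n) (Fin n) ℂ} (hX : X ∈ G.lieAlgebra) :
    (g : Matrix (Fin n) (Fin n) ℂ) * X * (g⁻¹ : GL (Fin n) ℂ) ∈ G.lieAlgebra := by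
  intro f hf hG
  have h := hX (fun A => f ((g : Matrix (Fin n) (Fin n) ℂ) * A * (g⁻¹ : GL (Fin n) ℂ)))
    (comp_linear_mem_polynomialFunctions
      ((LinearMap.mulRight ℂ ((g⁻¹ : GL (Fin n) ℂ) : Matrix (Fin n) (Fin n) ℂ)).comp
        (LinearMap.mulLeft ℂ (g : Matrix (Fin n) (Fin n) ℂ))) hf)
    (fun k hk => by
      simpa using hG (g * k * g⁻¹)
        (G.toSubgroup.mul_mem (G.toSubgroup.mul_mem hg hk) (G.toSubgroup.inv_mem hg)))
  have e : ∀ t : ℂ, (g : Matrix (Fin n) (Fin n) ℂ) * (1 + t • X) * (g⁻¹ : GL (Fin n) ℂ)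
      = 1 + t • ((g : Matrix (Fin n) (Fin n) ℂ) * X * (g⁻¹ : GL (Fin n) ℂ)) := by
    intro t
    have h1 : (g : Matrix (Fin n) (Fin n) ℂ) * (g⁻¹ : GL (Fin n) ℂ) = 1 := by
      rw [← Units.val_mul, mul_inv_cancel, Units.val_one]
    rw [mul_add, add_mul, mul_one, h1, mul_smul_comm, smul_mul_assoc]
  simp only [lineDeriv, e] at h ⊢
  exact h

/-- The adjoint representation `Ad : G → GL(𝔤)`, `Ad_g(X) = g X g⁻¹`. -/
def LinearAlgebraicGroup.Ad (G : LinearAlgebraicGroup n) :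
    Representation ℂ G.toSubgroup G.lieAlgebra where
  toFun g :=
    { toFun := fun X => ⟨(g.1 : Matrix (Fin n) (Fin n) ℂ) * X.1 * (g.1⁻¹ : GL (Fin n) ℂ),
        conj_mem_lieAlgebra G g.2 X.2⟩
      map_add' := fun X Y => Subtype.ext <| by
        change _ * (X.1 + Y.1) * _ = _ * X.1 * _ + _ * Y.1 * _
        rw [mul_add, add_mul]
      map_smul' := fun c X => Subtype.ext <| by
        change _ * (c • X.1) * _ = c • (_ * X.1 * _)
        rw [mul_smul_comm, smul_mul_assoc] }
  map_one' := LinearMap.ext fun X => Subtype.ext <| by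
    change ((1 : GL (Fin n) ℂ) : Matrix (Fin n) (Fin n) ℂ) * X.1 * ((1 : GL (Fin n) ℂ)⁻¹ : GL (Fin n) ℂ)
      = X.1
    simp
  map_mul' g h := LinearMap.ext fun X => Subtype.ext <| by
    change ((g.1 * h.1 : GL (Fin n) ℂ) : Matrix (Fin n) (Fin n) ℂ) * X.1
        * ((g.1 * h.1)⁻¹ : GL (Fin n) ℂ)
      = (g.1 : Matrix (Fin n) (Fin n) ℂ) * ((h.1 : Matrix (Fin n) (Fin n) ℂ) * X.1
        * (h.1⁻¹ : GL (Fin n) ℂ)) * (g.1⁻¹ : GL (Fin n) ℂ)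
    rw [mul_inv_rev, Units.val_mul, Units.val_mul]
    simp only [mul_assoc]

/-- The adjoint orbit `𝒪(x) = {Ad_g(x) : g ∈ G}`. -/
def LinearAlgebraicGroup.orbit (G : LinearAlgebraicGroup n) (x : G.lieAlgebra) :
    Set G.lieAlgebra :=
  Set.range fun g : G.toSubgroup => G.Ad g x

/-- The set of all adjoint orbits of `G`. -/
def AdjointOrbit (G : LinearAlgebraicGroup n) : Type :=
  {O : Set G.lieAlgebra // ∃ x, O = G.orbit x}

theorem mem_orbit_self (G : LinearAlgebraicGroup n) (x : G.lieAlgebra) : x ∈ G.orbit x :=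
  ⟨1, by simp⟩

theorem orbit_eq_of_mem (G : LinearAlgebraicGroup n) {x y : G.lieAlgebra} (h : y ∈ G.orbit x) :
    G.orbit y = G.orbit x := by
  obtain ⟨g, rfl⟩ := h
  ext z
  constructor
  · rintro ⟨k, rfl⟩
    exact ⟨k * g, by simp⟩
  · rintro ⟨k, rfl⟩
    exact ⟨k * g⁻¹, by
      change G.Ad (k * g⁻¹) (G.Ad g x) = G.Ad k x
      rw [← Module.End.mul_apply, ← map_mul, inv_mul_cancel_right]⟩

theorem exists_isOpen_of_isLocallyClosed {X ι : Type*} [TopologicalSpace X] (s : Finset ι)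
    (O : ι → Set X) (hO : ∀ i ∈ s, ∃ U Z : Set X, IsOpen U ∧ IsClosed Z ∧ O i = Z ∩ U)
    (hne : (⋃ i ∈ s, O i).Nonempty) :
    ∃ W : Set X, IsOpen W ∧ (W ∩ ⋃ i ∈ s, O i).Nonempty ∧
      W ∩ closure (⋃ i ∈ s, O i) ⊆ ⋃ i ∈ s, O i := by
  classical
  induction s using Finset.induction_on with
  | empty => simp at hne
  | insert i s hi ih =>
    rw [Finset.set_biUnion_insert] at hne ⊢
    by_cases h : O i ⊆ closure (⋃ j ∈ s, O j)
    · have hne' : (⋃ j ∈ s, O j).Nonempty := by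
        rcases hne with ⟨x, hx | hx⟩
        · exact closure_nonempty_iff.1 ⟨x, h hx⟩
        · exact ⟨x, hx⟩
      obtain ⟨W, hW, hW1, hW2⟩ := ih (fun j hj => hO j (Finset.mem_insert_of_mem hj)) hne'
      refine ⟨W, hW, hW1.mono (by gcongr; exact Set.subset_union_right), ?_⟩
      have : closure (O i ∪ ⋃ j ∈ s, O j) ⊆ closure (⋃ j ∈ s, O j) :=
        closure_minimal (Set.union_subset h subset_closure) isClosed_closure
      exact fun x hx => Or.inr (hW2 ⟨hx.1, this hx.2⟩)
    · obtain ⟨x, hx, hxs⟩ := Set.not_subset.1 h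
      obtain ⟨U, Z, hU, hZ, hUZ⟩ := hO i (Finset.mem_insert_self i s)
      refine ⟨U ∩ (closure (⋃ j ∈ s, O j))ᶜ, hU.inter isClosed_closure.isOpen_compl,
        ⟨x, ⟨(hUZ ▸ hx : x ∈ Z ∩ U).2, hxs⟩, Or.inl hx⟩, ?_⟩
      rintro y ⟨⟨hyU, hys⟩, hy⟩
      rw [closure_union] at hy
      rcases hy with hy | hy
      · refine Or.inl (hUZ ▸ ⟨?_, hyU⟩)
        exact closure_minimal (hUZ ▸ Set.inter_subset_left) hZ hy
      · exact absurd hy hys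

theorem exists_open_of_image {σ τ : Type*} [Finite σ] [Finite τ] (Z : Set (σ → ℂ))
    (hZ : ∀ z, (∀ P : MvPolynomial σ ℂ, (∀ w ∈ Z, MvPolynomial.eval w P = 0) →
      MvPolynomial.eval z P = 0) → z ∈ Z)
    (hne : Z.Nonempty) (Ψ : τ → MvPolynomial σ ℂ) :
    ∃ f : MvPolynomial τ ℂ,
      (∃ z ∈ Z, MvPolynomial.eval (fun i => MvPolynomial.eval z (Ψ i)) f ≠ 0) ∧
      ∀ p : τ → ℂ, (∀ q : MvPolynomial τ ℂ,
          (∀ z ∈ Z, MvPolynomial.eval (fun i => MvPolynomial.eval z (Ψ i)) q = 0) →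
            MvPolynomial.eval p q = 0) →
        MvPolynomial.eval p f ≠ 0 → ∃ z ∈ Z, (fun i => MvPolynomial.eval z (Ψ i)) = p := by
  classical
  let I : Ideal (MvPolynomial σ ℂ) := MvPolynomial.vanishingIdeal ℂ Z
  let ψ : MvPolynomial τ ℂ →+* MvPolynomial σ ℂ := (MvPolynomial.bind₁ Ψ).toRingHom
  have hψ : ∀ z q, MvPolynomial.eval z (ψ q)
      = MvPolynomial.eval (fun i => MvPolynomial.eval z (Ψ i)) q := by
    intro z q
    exact MvPolynomial.eval₂Hom_bind₁ (RingHom.id ℂ) z Ψ q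
  let φ : MvPolynomial τ ℂ →+* MvPolynomial σ ℂ ⧸ I := (Ideal.Quotient.mk I).comp ψ
  have hφ : φ.FinitePresentation := by
    have : φ.FiniteType := by
      have h1 : (φ.comp (MvPolynomial.C : ℂ →+* MvPolynomial τ ℂ)).FiniteType := by
        have : φ.comp (MvPolynomial.C : ℂ →+* MvPolynomial τ ℂ)
            = algebraMap ℂ (MvPolynomial σ ℂ ⧸ I) := by
          ext a
          simp [φ, ψ]
          rfl
        rw [this, RingHom.finiteType_algebraMap]
        infer_instance
      exact RingHom.FiniteType.of_comp_finiteType h1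
    exact RingHom.FinitePresentation.of_finiteType.1 this
  obtain ⟨S, hS⟩ := PrimeSpectrum.exists_constructibleSetData_iff.2
    (PrimeSpectrum.isConstructible_range_comap hφ)
  let pt : (τ → ℂ) → PrimeSpectrum (MvPolynomial τ ℂ) := MvPolynomial.pointToPoint
  let _ : TopologicalSpace (τ → ℂ) := TopologicalSpace.induced pt inferInstance
  have hpt : ∀ p q, q ∈ (pt p).asIdeal ↔ MvPolynomial.eval p q = 0 := by
    intro p q
    exact MvPolynomial.mem_vanishingIdeal_singleton_iff p q
  have hcl : ∀ T : Set (PrimeSpectrum (MvPolynomial τ ℂ)), IsClosed T → IsClosed (pt ⁻¹' T) :=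
    fun T hT => hT.preimage continuous_induced_dom
  -- points of the image
  have key : ∀ p, p ∈ pt ⁻¹' (Set.range (PrimeSpectrum.comap φ)) ↔
      ∃ z ∈ Z, (fun i => MvPolynomial.eval z (Ψ i)) = p := by
    intro p
    constructor
    · rintro ⟨P, hP⟩
      obtain ⟨M, hM, hPM⟩ := P.asIdeal.exists_le_maximal P.isPrime.ne_top
      have hM' : (M.comap (Ideal.Quotient.mk I)).IsMaximal :=
        Ideal.comap_isMaximal_of_surjective _ Ideal.Quotient.mk_surjective
      obtain ⟨z, hz⟩ := MvPolynomial.isMaximal_iff_eq_vanishingIdeal_singleton.1 hM'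
      have hzM : ∀ Q, Ideal.Quotient.mk I Q ∈ M ↔ MvPolynomial.eval z Q = 0 := by
        intro Q
        rw [← Ideal.mem_comap, hz]
        exact MvPolynomial.mem_vanishingIdeal_singleton_iff z Q
      refine ⟨z, hZ z fun Q hQ => ?_, ?_⟩
      · rw [← hzM, Ideal.Quotient.eq_zero_iff_mem.2 (show Q ∈ I from hQ)]
        exact M.zero_mem
      · ext i
        have h1 : MvPolynomial.X i - MvPolynomial.C (p i) ∈ (pt p).asIdeal := by
          rw [hpt]; simp
        rw [← hP] at h1
        have h2 := (hzM _).1 (hPM h1)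
        rw [hψ] at h2
        simpa [sub_eq_zero] using h2
    · rintro ⟨z, hz, rfl⟩
      let θ : MvPolynomial σ ℂ ⧸ I →+* ℂ := Ideal.Quotient.lift I (MvPolynomial.eval z)
        (fun a ha => ha z hz)
      refine ⟨⟨RingHom.ker θ, RingHom.ker_isPrime θ⟩, ?_⟩
      ext q
      rw [hpt, ← hψ]
      rfl
  have hO : {p | ∃ z ∈ Z, (fun i => MvPolynomial.eval z (Ψ i)) = p}
      = ⋃ C ∈ S, pt ⁻¹' C.toSet := by
    ext p
    rw [Set.mem_ofPred_eq, ← key p, ← hS]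
    simp [PrimeSpectrum.ConstructibleSetData.toSet]
  obtain ⟨z₀, hz₀⟩ := hne
  obtain ⟨W, hW, hW1, hW2⟩ := exists_isOpen_of_isLocallyClosed S (fun C => pt ⁻¹' C.toSet)
    (fun C _ => ⟨pt ⁻¹' (PrimeSpectrum.zeroLocus {C.f})ᶜ,
      pt ⁻¹' PrimeSpectrum.zeroLocus (Set.range C.g),
      (hcl _ (PrimeSpectrum.isClosed_zeroLocus _)).isOpen_compl,
      hcl _ (PrimeSpectrum.isClosed_zeroLocus _), rfl⟩)
    (hO ▸ ⟨_, z₀, hz₀, rfl⟩)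
  rw [← hO] at hW1 hW2
  obtain ⟨_, hzW, z, hz, rfl⟩ := hW1
  obtain ⟨T, hT, rfl⟩ := isOpen_induced_iff.1 hW
  obtain ⟨_, ⟨f, rfl⟩, hf, hfT⟩ :=
    PrimeSpectrum.isTopologicalBasis_basic_opens.exists_subset_of_mem_open hzW hT
  refine ⟨f, ⟨z, hz, fun h => hf ((hpt _ _).2 h)⟩, fun p hp hfp => ?_⟩
  refine hW2 ⟨hfT fun h => hfp ((hpt _ _).1 h), ?_⟩
  obtain ⟨C, hC, hCO⟩ := isClosed_induced_iff.1
    (isClosed_closure (s := {p | ∃ z ∈ Z, (fun i => MvPolynomial.eval z (Ψ i)) = p}))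
  obtain ⟨F, rfl⟩ := (PrimeSpectrum.isClosed_iff_zeroLocus C).1 hC
  rw [← hCO]
  intro q hq
  refine (hpt _ _).2 (hp q fun z hz => (hpt _ _).1 ?_)
  have : (fun i => MvPolynomial.eval z (Ψ i)) ∈
      closure {p | ∃ z ∈ Z, (fun i => MvPolynomial.eval z (Ψ i)) = p} :=
    subset_closure ⟨z, hz, rfl⟩
  rw [← hCO] at this
  exact this hq

theorem exists_mvPolynomial_eval {σ : Type*} [Fintype σ] {f : (σ → ℂ) → ℂ}
    (hf : f ∈ polynomialFunctions (σ → ℂ)) :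
    ∃ P : MvPolynomial σ ℂ, ∀ z, MvPolynomial.eval z P = f z := by
  classical
  induction hf using Algebra.adjoin_induction with
  | mem x hx =>
    obtain ⟨φ, rfl⟩ := hx
    refine ⟨∑ i, MvPolynomial.C (φ (Pi.single i 1)) * MvPolynomial.X i, fun z => ?_⟩
    have hz : z = ∑ i, z i • (Pi.single i 1 : σ → ℂ) := by
      ext j
      simp [Finset.sum_apply, Pi.single_apply]
    change _ = φ z
    conv_rhs => rw [hz, map_sum]
    simp [mul_comm]
  | algebraMap r => exact ⟨MvPolynomial.C r, fun z => by simp⟩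
  | add x y _ _ hx hy =>
    obtain ⟨P, hP⟩ := hx
    obtain ⟨Q, hQ⟩ := hy
    exact ⟨P + Q, fun z => by simp [hP, hQ]⟩
  | mul x y _ _ hx hy =>
    obtain ⟨P, hP⟩ := hx
    obtain ⟨Q, hQ⟩ := hy
    exact ⟨P * Q, fun z => by simp [hP, hQ]⟩

theorem eval_mem_polynomialFunctions {τ V : Type*} [AddCommGroup V] [Module ℂ V]
    (φ : τ → Module.Dual ℂ V) (q : MvPolynomial τ ℂ) :
    (fun v => MvPolynomial.eval (fun i => φ i v) q) ∈ polynomialFunctions V := by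
  induction q using MvPolynomial.induction_on with
  | C a =>
    simp only [MvPolynomial.eval_C]
    exact (polynomialFunctions V).algebraMap_mem a
  | add p q hp hq =>
    simp only [map_add]
    exact (polynomialFunctions V).add_mem hp hq
  | mul_X p i hp =>
    simp only [map_mul, MvPolynomial.eval_X]
    exact (polynomialFunctions V).mul_mem hp (linear_mem_polynomialFunctions (φ i))

theorem exists_open_of_orbit (G : LinearAlgebraicGroup n) (x : G.lieAlgebra) :
    ∃ f ∈ polynomialFunctions G.lieAlgebra, (∃ y ∈ G.orbit x, f y ≠ 0) ∧
      ∀ y ∈ closure[zariskiTopology G.lieAlgebra] (G.orbit x), f y ≠ 0 → y ∈ G.orbit x := by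
  classical
  let gm : ((Fin n × Fin n) ⊕ (Fin n × Fin n) → ℂ) →ₗ[ℂ] Matrix (Fin n) (Fin n) ℂ :=
    { toFun := fun z => Matrix.of fun i j => z (Sum.inl (i, j))
      map_add' := fun _ _ => rfl
      map_smul' := fun _ _ => rfl }
  let hm : ((Fin n × Fin n) ⊕ (Fin n × Fin n) → ℂ) → Matrix (Fin n) (Fin n) ℂ :=
    fun z => Matrix.of fun i j => z (Sum.inr (i, j))
  let pr : Matrix (Fin n) (Fin n) ℂ → Matrix (Fin n) (Fin n) ℂ →
    ((Fin n × Fin n) ⊕ (Fin n × Fin n) → ℂ) :=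
    fun A B => Sum.elim (fun i => A i.1 i.2) (fun i => B i.1 i.2)
  let Z : Set ((Fin n × Fin n) ⊕ (Fin n × Fin n) → ℂ) :=
    {z | gm z * hm z = 1 ∧ ∀ f ∈ polynomialFunctions (Matrix (Fin n) (Fin n) ℂ),
      (∀ g ∈ G.toSubgroup, f (g : Matrix (Fin n) (Fin n) ℂ) = 0) → f (gm z) = 0}
  have hZG : ∀ z, z ∈ Z ↔ ∃ g ∈ G.toSubgroup, z = pr (g : Matrix (Fin n) (Fin n) ℂ)
      ((g⁻¹ : GL (Fin n) ℂ) : Matrix (Fin n) (Fin n) ℂ) := by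
    intro z
    constructor
    · rintro ⟨h1, h2⟩
      refine ⟨⟨gm z, hm z, h1, mul_eq_one_comm.1 h1⟩, G.mem_of_forall h2, ?_⟩
      ext (i | i) <;> rfl
    · rintro ⟨g, hg, rfl⟩
      refine ⟨?_, fun f _ hf => hf g hg⟩
      change (g : Matrix (Fin n) (Fin n) ℂ) * ((g⁻¹ : GL (Fin n) ℂ) : Matrix (Fin n) (Fin n) ℂ) = 1
      rw [← Units.val_mul, mul_inv_cancel, Units.val_one]
  let Ψ : Fin n × Fin n → MvPolynomial ((Fin n × Fin n) ⊕ (Fin n × Fin n)) ℂ := fun ij =>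
    ∑ l, (∑ k, MvPolynomial.X (Sum.inl (ij.1, k)) * MvPolynomial.C (x.1 k l)) *
      MvPolynomial.X (Sum.inr (l, ij.2))
  have hΨ : ∀ z ij, MvPolynomial.eval z (Ψ ij) = (gm z * x.1 * hm z) ij.1 ij.2 := by
    intro z ij
    simp [Ψ, Matrix.mul_apply, gm, hm]
    rfl
  have hZcl : ∀ z, (∀ P : MvPolynomial ((Fin n × Fin n) ⊕ (Fin n × Fin n)) ℂ,
      (∀ w ∈ Z, MvPolynomial.eval w P = 0) → MvPolynomial.eval z P = 0) → z ∈ Z := by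
    intro z hz
    refine ⟨?_, fun f hf hG => ?_⟩
    · ext i j
      have key : ∀ w, MvPolynomial.eval w (∑ k, MvPolynomial.X (Sum.inl (i, k)) *
          MvPolynomial.X (Sum.inr (k, j)) -
          MvPolynomial.C ((1 : Matrix (Fin n) (Fin n) ℂ) i j))
          = (gm w * hm w) i j - (1 : Matrix (Fin n) (Fin n) ℂ) i j := by
        intro w
        simp [Matrix.mul_apply, gm, hm]
        rfl
      have := hz _ fun w hw => by rw [key, hw.1, sub_self]
      rw [key] at this
      exact sub_eq_zero.1 this
    · obtain ⟨P, hP⟩ := exists_mvPolynomial_eval (comp_linear_mem_polynomialFunctions gm hf)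
      rw [← hP z]
      exact hz P fun w hw => by rw [hP]; exact hw.2 f hf hG
  have hne : Z.Nonempty := ⟨_, (hZG _).2 ⟨1, G.toSubgroup.one_mem, rfl⟩⟩
  obtain ⟨f, ⟨z, hz, hfz⟩, hf⟩ := exists_open_of_image Z hZcl hne Ψ
  let en : Fin n × Fin n → Module.Dual ℂ G.lieAlgebra := fun ij =>
    { toFun := fun y => y.1 ij.1 ij.2
      map_add' := fun _ _ => rfl
      map_smul' := fun _ _ => rfl }
  have hen : ∀ (g : G.toSubgroup), (fun ij => en ij (G.Ad g x)) = fun ij =>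
      MvPolynomial.eval (pr (g.1 : Matrix (Fin n) (Fin n) ℂ)
        ((g.1⁻¹ : GL (Fin n) ℂ) : Matrix (Fin n) (Fin n) ℂ)) (Ψ ij) := by
    intro g
    ext ij
    rw [hΨ]
    rfl
  refine ⟨_, eval_mem_polynomialFunctions en f, ?_, fun y hy hfy => ?_⟩
  · obtain ⟨g, hg, rfl⟩ := (hZG z).1 hz
    exact ⟨G.Ad ⟨g, hg⟩ x, ⟨_, rfl⟩, by rw [hen]; exact hfz⟩
  · obtain ⟨z, hz, hzy⟩ := hf (fun ij => en ij y) (fun q hq =>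
      mem_closure_zariski_iff.1 hy _ (eval_mem_polynomialFunctions en q) (by
        rintro _ ⟨g, rfl⟩
        rw [hen]
        exact hq _ ((hZG _).2 ⟨g.1, g.2, rfl⟩))) hfy
    obtain ⟨g, hg, rfl⟩ := (hZG z).1 hz
    refine ⟨⟨g, hg⟩, Subtype.ext (Matrix.ext fun i j => ?_)⟩
    have h1 := congrFun (hen ⟨g, hg⟩) (i, j)
    have h2 := congrFun hzy (i, j)
    exact h1.trans h2

/-- The closure order on the set of adjoint orbits: `𝒪₁ ≤ 𝒪₂` iff `𝒪₁` is contained in the Zariski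
closure of `𝒪₂` in `𝔤`. -/
instance closureOrder (G : LinearAlgebraicGroup n) : PartialOrder (AdjointOrbit G) where
  le O₁ O₂ := O₁.1 ⊆ closure[zariskiTopology G.lieAlgebra] O₂.1
  le_refl O := by
    let _ := zariskiTopology G.lieAlgebra
    exact subset_closure
  le_trans O₁ O₂ O₃ h h' := by
    let _ := zariskiTopology G.lieAlgebra
    exact h.trans (closure_minimal h' isClosed_closure)
  le_antisymm := by
    rintro ⟨_, x, rfl⟩ ⟨_, y, rfl⟩ h h'
    obtain ⟨f, hf, ⟨a, ha, hfa⟩, H⟩ := exists_open_of_orbit G x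
    have : ∃ b ∈ G.orbit y, f b ≠ 0 := by
      by_contra! hc
      exact hfa (mem_closure_zariski_iff.1 (h ha) f hf hc)
    obtain ⟨b, hb, hfb⟩ := this
    have hb' := H b (h' hb) hfb
    exact Subtype.ext ((orbit_eq_of_mem G hb').symm.trans (orbit_eq_of_mem G hb))

/-- The orbit `{0}` of the zero element of `𝔤`. -/
def zeroOrbit (G : LinearAlgebraicGroup n) : AdjointOrbit G :=
  ⟨{0}, 0, by simp [LinearAlgebraicGroup.orbit]⟩

/-- The nilpotent cone `𝒩 ⊆ 𝔤`: the elements `x` for which `ad_x` is a nilpotent endomorphism. -/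
def nilpotentCone (G : LinearAlgebraicGroup n) : Set G.lieAlgebra :=
  {x | IsNilpotent (LieAlgebra.ad ℂ G.lieAlgebra x)}

/-- The set of nilpotent orbits, that is, of adjoint orbits meeting the nilpotent cone. -/
def nilpotentOrbits (G : LinearAlgebraicGroup n) : Set (AdjointOrbit G) :=
  {O | (O.1 ∩ nilpotentCone G).Nonempty}

/-- `G` is connected (in the Zariski topology). -/
def LinearAlgebraicGroup.IsConnected (G : LinearAlgebraicGroup n) : Prop :=
  @_root_.IsConnected _ (zariskiTopologyGL n) (G.toSubgroup : Set (GL (Fin n) ℂ))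

/-- `G` is a connected semisimple group: it is connected and its radical is trivial, i.e. its only
connected solvable closed normal subgroup is the trivial one. -/
structure LinearAlgebraicGroup.IsConnectedSemisimple (G : LinearAlgebraicGroup n) : Prop where
  connected : G.IsConnected
  radical_trivial : ∀ H : LinearAlgebraicGroup n, H.toSubgroup ≤ G.toSubgroup →
    (H.toSubgroup.subgroupOf G.toSubgroup).Normal → H.IsConnected → Group.IsSolvable H.toSubgroup →
      H.toSubgroup = ⊥

/-- `p` and `q` are joined by a finite sequence of comparisons between elements of `Q`. -/
def ComparisonPath {P : Type*} [PartialOrder P] (Q : Set P) (p q : P) : Prop :=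
  ∃ (k : ℕ) (r : Fin (k + 1) → P), (∀ j, r j ∈ Q) ∧ r 0 = p ∧ r (Fin.last k) = q ∧
    ∀ j : Fin k, r j.castSucc ≤ r j.succ ∨ r j.succ ≤ r j.castSucc

/-- A connected component of a poset: a subset that is maximal among the subsets any two of whose
elements are joined by a finite sequence of comparisons within the subset. -/
def IsPosetComponent {P : Type*} [PartialOrder P] (Q : Set P) : Prop :=
  Maximal (fun Q : Set P => ∀ p ∈ Q, ∀ q ∈ Q, ComparisonPath Q p q) Q

end AdjointOrbits

end

/-! Nilpotency cannot change along a comparison. The coefficients of the characteristic polynomial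
of `ad x` are `Ad`-invariant polynomial functions of `x`, hence constant on the closure of an orbit,
and `x` is nilpotent exactly when this polynomial is a power of the variable
(`charpoly_ad_eq_of_mem_closure`). So no path of comparisons enters or leaves the set of nilpotent
orbits.

Conversely, `0` lies in the closure of every nilpotent orbit. If the Killing form is nondegenerate,
a nilpotent `x` satisfies `⁅h, x⁆ = x` for some `h` (`exists_lie_eq_self_of_isNilpotent_ad`); no
full `sl₂`-triple is needed. The elements `exp (t h)` lie in `G` and scale `x` by `e ^ t`, so the
orbit contains every nonzero multiple of `x`, and `0` is a limit of these.

It remains to pass from the group to the Killing form. An `Ad`-stable abelian ideal exponentiates to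
a commutative group, normalized by `G`, whose Zariski closure is closed, connected, commutative and
normal in `G`, hence trivial; so the ideal vanishes (`eq_bot_of_isLieAbelian`). Applied to the last
nonzero derived term of the radical, this shows that the radical of `𝔤` is zero, and Cartan's
criterion gives nondegeneracy. -/

noncomputable section

namespace AdjointOrbits

attribute [local instance] LieRing.ofAssociativeRing

variable {n : ℕ}

/-! ### The adjoint action by Lie algebra automorphisms -/

/-- `Ad_g` as an automorphism of the Lie algebra `𝔤`. -/
def LinearAlgebraicGroup.AdEquiv (G : LinearAlgebraicGroup n) (g : G.toSubgroup) :
    G.lieAlgebra ≃ₗ⁅ℂ⁆ G.lieAlgebra where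
  toLinearMap := G.Ad g
  invFun := G.Ad g⁻¹
  left_inv x := by
    change G.Ad g⁻¹ (G.Ad g x) = x
    rw [← Module.End.mul_apply, ← map_mul, inv_mul_cancel, map_one, Module.End.one_apply]
  right_inv x := by
    change G.Ad g (G.Ad g⁻¹ x) = x
    rw [← Module.End.mul_apply, ← map_mul, mul_inv_cancel, map_one, Module.End.one_apply]
  map_lie' {x y} := Subtype.ext <| by
    have h : ((g.1⁻¹ : GL (Fin n) ℂ) : Matrix (Fin n) (Fin n) ℂ) * (g.1 : GL (Fin n) ℂ) = 1 := by
      rw [← Units.val_mul, inv_mul_cancel, Units.val_one]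
    have key : ∀ A B P Q : Matrix (Fin n) (Fin n) ℂ, Q * P = 1 →
        P * (A * B - B * A) * Q = P * A * Q * (P * B * Q) - P * B * Q * (P * A * Q) := by
      intro A B P Q h
      have : ∀ A B : Matrix (Fin n) (Fin n) ℂ, P * A * Q * (P * B * Q) = P * (A * B) * Q := by
        intro A B
        calc P * A * Q * (P * B * Q) = P * A * (Q * P) * B * Q := by simp only [mul_assoc]
          _ = P * (A * B) * Q := by rw [h, mul_one]; simp only [mul_assoc]
      rw [this, this, mul_sub, sub_mul]
    exact key x.1 y.1 _ _ h

theorem coe_Ad_apply (G : LinearAlgebraicGroup n) (g : G.toSubgroup) (x : G.lieAlgebra) :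
    (G.Ad g x : Matrix (Fin n) (Fin n) ℂ)
      = (g.1 : Matrix (Fin n) (Fin n) ℂ) * x.1 * (g.1⁻¹ : GL (Fin n) ℂ) :=
  rfl

theorem AdEquiv_apply (G : LinearAlgebraicGroup n) (g : G.toSubgroup) (x : G.lieAlgebra) :
    G.AdEquiv g x = G.Ad g x :=
  rfl

/-! ### The characteristic polynomial of `ad_x` -/

theorem charpoly_ad_Ad (G : LinearAlgebraicGroup n) (g : G.toSubgroup) (x : G.lieAlgebra) :
    (LieAlgebra.ad ℂ G.lieAlgebra (G.Ad g x)).charpoly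
      = (LieAlgebra.ad ℂ G.lieAlgebra x).charpoly := by
  rw [← AdEquiv_apply, ← LieAlgebra.conj_ad_apply, LinearEquiv.charpoly_conj]

theorem charpoly_ad_eq_of_mem_closure (G : LinearAlgebraicGroup n) {x y : G.lieAlgebra}
    (h : y ∈ closure[zariskiTopology G.lieAlgebra] (G.orbit x)) :
    (LieAlgebra.ad ℂ G.lieAlgebra y).charpoly = (LieAlgebra.ad ℂ G.lieAlgebra x).charpoly := by
  ext i
  let b := Module.finBasis ℂ G.lieAlgebra
  let P := ((LinearMap.polyCharpoly (LieAlgebra.ad ℂ G.lieAlgebra).toLinearMap b).coeff i)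
  have hP : ∀ z, MvPolynomial.eval (fun j => b.coord j z) P
      = (LieAlgebra.ad ℂ G.lieAlgebra z).charpoly.coeff i := fun z =>
    LinearMap.polyCharpoly_coeff_eval (LieAlgebra.ad ℂ G.lieAlgebra).toLinearMap b z i
  -- The `i`-th coefficient minus its value at `x`: a polynomial function vanishing on the orbit,
  -- hence at `y`.
  have hmem := (polynomialFunctions G.lieAlgebra).sub_mem
    (eval_mem_polynomialFunctions (fun j => b.coord j) P)
    ((polynomialFunctions G.lieAlgebra).algebraMap_mem
      ((LieAlgebra.ad ℂ G.lieAlgebra x).charpoly.coeff i))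
  have h0 := mem_closure_zariski_iff.1 h _ hmem (by
    rintro _ ⟨g, rfl⟩
    simp only [Pi.sub_apply, hP, charpoly_ad_Ad]
    exact sub_self _)
  simp only [Pi.sub_apply, hP] at h0
  exact sub_eq_zero.1 h0

theorem mem_nilpotentCone_iff_charpoly (G : LinearAlgebraicGroup n) (x : G.lieAlgebra) :
    x ∈ nilpotentCone G ↔ (LieAlgebra.ad ℂ G.lieAlgebra x).charpoly
      = Polynomial.X ^ Module.finrank ℂ G.lieAlgebra :=
  ((LinearMap.charpoly_nilpotent_tfae (LieAlgebra.ad ℂ G.lieAlgebra x)).out 0 1)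

theorem mem_nilpotentCone_iff_of_mem_closure (G : LinearAlgebraicGroup n) {x y : G.lieAlgebra}
    (h : y ∈ closure[zariskiTopology G.lieAlgebra] (G.orbit x)) :
    y ∈ nilpotentCone G ↔ x ∈ nilpotentCone G := by
  rw [mem_nilpotentCone_iff_charpoly, mem_nilpotentCone_iff_charpoly,
    charpoly_ad_eq_of_mem_closure G h]

theorem orbit_mem_nilpotentOrbits_iff (G : LinearAlgebraicGroup n) (O : AdjointOrbit G)
    {x : G.lieAlgebra} (hx : O.1 = G.orbit x) :
    O ∈ nilpotentOrbits G ↔ x ∈ nilpotentCone G := by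
  let _ := zariskiTopology G.lieAlgebra
  constructor
  · rintro ⟨y, hy, hyN⟩
    exact (mem_nilpotentCone_iff_of_mem_closure G (subset_closure (hx ▸ hy))).1 hyN
  · exact fun h => ⟨x, hx ▸ mem_orbit_self G x, h⟩

theorem mem_nilpotentOrbits_iff_of_le (G : LinearAlgebraicGroup n) {O₁ O₂ : AdjointOrbit G}
    (h : O₁ ≤ O₂) : O₁ ∈ nilpotentOrbits G ↔ O₂ ∈ nilpotentOrbits G := by
  obtain ⟨x, hx⟩ := O₁.2
  obtain ⟨y, hy⟩ := O₂.2
  rw [orbit_mem_nilpotentOrbits_iff G O₁ hx, orbit_mem_nilpotentOrbits_iff G O₂ hy]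
  refine mem_nilpotentCone_iff_of_mem_closure G ?_
  rw [← hy]
  exact h (hx ▸ mem_orbit_self G x)

theorem zeroOrbit_mem_nilpotentOrbits (G : LinearAlgebraicGroup n) :
    zeroOrbit G ∈ nilpotentOrbits G :=
  ⟨0, rfl, by simp [nilpotentCone]⟩

/-! ### One-parameter subgroups -/

section Exponential

attribute [local instance] Matrix.linftyOpNormedRing Matrix.linftyOpNormedAlgebra

/-- The curve `exp (s X)` is an integral curve of the vector field `A ↦ A X`, along which
`fieldDerivation` differentiates. -/
theorem hasDerivAt_evalPoly_exp (X : Matrix (Fin n) (Fin n) ℂ)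
    (p : MvPolynomial (Module.Dual ℂ (Matrix (Fin n) (Fin n) ℂ)) ℂ) (t : ℂ) :
    HasDerivAt (fun s : ℂ => evalPoly _ p (NormedSpace.exp (s • X)))
      (evalPoly _ (fieldDerivation (LinearMap.mulRight ℂ X) p) (NormedSpace.exp (t • X))) t := by
  induction p using MvPolynomial.induction_on with
  | C a => simpa [evalPoly, fieldDerivation] using hasDerivAt_const t a
  | add p q hp hq =>
    simp only [map_add]
    exact hp.add hq
  | mul_X p φ hp =>
    have h2 : HasDerivAt (fun s : ℂ => φ (NormedSpace.exp (s • X)))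
        (φ (NormedSpace.exp (t • X) * X)) t :=
      (LinearMap.toContinuousLinearMap φ).hasFDerivAt.comp_hasDerivAt t
        (hasDerivAt_exp_smul_const X t)
    have h := hp.mul h2
    have e : evalPoly _ (fieldDerivation (LinearMap.mulRight ℂ X) (p * MvPolynomial.X φ))
          (NormedSpace.exp (t • X))
        = evalPoly _ (fieldDerivation (LinearMap.mulRight ℂ X) p) (NormedSpace.exp (t • X))
            * φ (NormedSpace.exp (t • X))
          + evalPoly _ p (NormedSpace.exp (t • X)) * φ (NormedSpace.exp (t • X) * X) := by
      rw [Derivation.leibniz]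
      simp [evalPoly, fieldDerivation, MvPolynomial.mkDerivation_X, mul_comm, add_comm]
    have e' : evalPoly (Matrix (Fin n) (Fin n) ℂ) (p * MvPolynomial.X φ) = evalPoly _ p * φ := by
      simp [evalPoly]
    rw [e, e']
    exact h

/-- The function is entire in `t`, and its Taylor coefficients at `0` are, up to factorials, the
values at the identity of the iterated derivatives `D^[k] p`. Since `X` is tangent to `G`, `D`
preserves the polynomials vanishing on `G`, so all of these are zero. -/
theorem evalPoly_exp_eq_zero (G : LinearAlgebraicGroup n) (X : G.lieAlgebra)
    (p : MvPolynomial (Module.Dual ℂ (Matrix (Fin n) (Fin n) ℂ)) ℂ)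
    (hp : ∀ g ∈ G.toSubgroup, evalPoly _ p (g : Matrix (Fin n) (Fin n) ℂ) = 0) (t : ℂ) :
    evalPoly _ p (NormedSpace.exp (t • X.1)) = 0 := by
  let D := fieldDerivation (LinearMap.mulRight ℂ X.1)
  have hit : ∀ k, iteratedDeriv k (fun s : ℂ => evalPoly _ p (NormedSpace.exp (s • X.1)))
      = fun s => evalPoly _ (D^[k] p) (NormedSpace.exp (s • X.1)) := by
    intro k
    induction k with
    | zero => simp
    | succ k ih =>
      rw [iteratedDeriv_succ, ih, Function.iterate_succ_apply']
      exact funext fun s => (hasDerivAt_evalPoly_exp X.1 _ s).deriv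
  have hvan : ∀ k, ∀ g ∈ G.toSubgroup,
      evalPoly _ (D^[k] p) (g : Matrix (Fin n) (Fin n) ℂ) = 0 := by
    intro k
    induction k with
    | zero => exact hp
    | succ k ih =>
      rw [Function.iterate_succ_apply']
      exact fieldDerivation_vanish G X.2 _ ih
  have hd : Differentiable ℂ fun s : ℂ => evalPoly _ p (NormedSpace.exp (s • X.1)) :=
    fun s => (hasDerivAt_evalPoly_exp X.1 p s).differentiableAt
  rw [← Complex.taylorSeries_eq_of_entire' 0 t hd]
  refine (tsum_congr fun k => ?_).trans tsum_zero
  have h1 := hvan k 1 G.toSubgroup.one_mem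
  rw [hit]
  simp only [zero_smul, NormedSpace.exp_zero]
  rw [Units.val_one] at h1
  rw [h1]
  ring

/-- The exponential of a matrix, as an invertible matrix. -/
def expGL (X : Matrix (Fin n) (Fin n) ℂ) : GL (Fin n) ℂ where
  val := NormedSpace.exp X
  inv := NormedSpace.exp (-X)
  val_inv := by
    rw [← Matrix.exp_add_of_commute _ _ (Commute.neg_right (Commute.refl X)), add_neg_cancel,
      NormedSpace.exp_zero]
  inv_val := by
    rw [← Matrix.exp_add_of_commute _ _ (Commute.neg_left (Commute.refl X)), neg_add_cancel,
      NormedSpace.exp_zero]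

theorem coe_expGL (X : Matrix (Fin n) (Fin n) ℂ) :
    (expGL X : Matrix (Fin n) (Fin n) ℂ) = NormedSpace.exp X :=
  rfl

theorem expGL_mem (G : LinearAlgebraicGroup n) (X : G.lieAlgebra) :
    expGL X.1 ∈ G.toSubgroup := by
  refine G.mem_of_forall fun f hf hG => ?_
  obtain ⟨p, rfl⟩ := exists_evalPoly_eq hf
  simpa [coe_expGL] using evalPoly_exp_eq_zero G X p hG 1

theorem expGL_zero : expGL (0 : Matrix (Fin n) (Fin n) ℂ) = 1 :=
  Units.ext (by rw [coe_expGL, NormedSpace.exp_zero, Units.val_one])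

theorem expGL_add {X Y : Matrix (Fin n) (Fin n) ℂ} (h : Commute X Y) :
    expGL (X + Y) = expGL X * expGL Y :=
  Units.ext (Matrix.exp_add_of_commute _ _ h)

theorem expGL_neg (X : Matrix (Fin n) (Fin n) ℂ) : expGL (-X) = (expGL X)⁻¹ :=
  Units.ext rfl

theorem expGL_conj (g : GL (Fin n) ℂ) (X : Matrix (Fin n) (Fin n) ℂ) :
    expGL ((g : Matrix (Fin n) (Fin n) ℂ) * X * ((g⁻¹ : GL (Fin n) ℂ) : Matrix (Fin n) (Fin n) ℂ)) = g * expGL X * g⁻¹ :=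
  Units.ext <| by
    rw [coe_expGL, Matrix.coe_units_inv, Matrix.exp_conj _ _ g.isUnit]
    simp [coe_expGL]

theorem eq_zero_of_expGL_smul_eq_one {X : Matrix (Fin n) (Fin n) ℂ}
    (h : ∀ t : ℂ, expGL (t • X) = 1) : X = 0 := by
  have h1 := hasDerivAt_exp_smul_const X (0 : ℂ)
  have h2 : (fun t : ℂ => NormedSpace.exp (t • X)) = fun _ => 1 :=
    funext fun t => congrArg Units.val (h t)
  have h3 := h1.unique ((hasDerivAt_const (0 : ℂ) (1 : Matrix (Fin n) (Fin n) ℂ)).congr_of_eventuallyEq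
    (Filter.Eventually.of_forall (congrFun h2)))
  simpa using h3

theorem exp_mul_mul_exp_neg {H X : Matrix (Fin n) (Fin n) ℂ} (h : H * X - X * H = X) (t : ℂ) :
    NormedSpace.exp (t • H) * X * NormedSpace.exp (-(t • H)) = Complex.exp t • X := by
  -- The relation reads `H X = X (H + 1)`, so `X` intertwines `t (H + 1)` with `t H`, and therefore
  -- their exponentials; the summand `t` contributes the scalar `e ^ t`.
  have hs : SemiconjBy X (t • H + t • 1) (t • H) := by
    have : H * X = X * H + X := by rw [← sub_eq_iff_eq_add', h]
    simp only [SemiconjBy, mul_add, smul_mul_assoc, mul_smul_comm, this, mul_one, smul_add]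
  have hc : Commute (t • H) (t • (1 : Matrix (Fin n) (Fin n) ℂ)) :=
    ((Commute.one_right H).smul_left t).smul_right t
  have h2 : NormedSpace.exp (t • (1 : Matrix (Fin n) (Fin n) ℂ)) = Complex.exp t • 1 := by
    have := NormedSpace.algebraMap_exp_comm (𝔸 := Matrix (Fin n) (Fin n) ℂ) t
    rw [Complex.exp_eq_exp_ℂ, ← Algebra.algebraMap_eq_smul_one, ← Algebra.algebraMap_eq_smul_one,
      this]
    rfl
  have h3 : NormedSpace.exp (t • H + t • 1)
      = NormedSpace.exp (t • H) * NormedSpace.exp (t • (1 : Matrix (Fin n) (Fin n) ℂ)) :=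
    Matrix.exp_add_of_commute _ _ hc
  rw [h2] at h3
  have h4 : X * NormedSpace.exp (t • H + t • 1) = NormedSpace.exp (t • H) * X := hs.exp_right
  rw [h3] at h4
  have h5 : NormedSpace.exp (t • H) * NormedSpace.exp (-(t • H)) = 1 := (expGL (t • H)).val_inv
  rw [← h4, mul_assoc, mul_assoc, smul_mul_assoc, one_mul, mul_smul_comm, mul_smul_comm, h5,
    mul_one]

end Exponential

/-! ### Nilpotent elements over a nondegenerate Killing form -/

/-- The range of `ad x` is its own double orthogonal for the Killing form. By invariance, anything
orthogonal to it commutes with `x`; for such `y`, `ad y ∘ ad x` is nilpotent and so has trace zero.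
Hence `x` itself lies in the range. -/
theorem exists_lie_eq_self_of_isNilpotent_ad {L : Type*} [LieRing L] [LieAlgebra ℂ L]
    [Module.Finite ℂ L] [LieAlgebra.IsKilling ℂ L] {x : L}
    (hx : IsNilpotent (LieAlgebra.ad ℂ L x)) : ∃ h : L, ⁅h, x⁆ = x := by
  suffices x ∈ LinearMap.range (LieAlgebra.ad ℂ L x) by
    obtain ⟨z, hz⟩ := this
    exact ⟨-z, by rw [neg_lie, lie_skew]; exact hz⟩
  let B := killingForm ℂ L
  have hB : B.Nondegenerate := LieAlgebra.IsKilling.killingForm_nondegenerate ℂ L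
  have hrefl : B.IsRefl := (LieModule.traceForm_isSymm ℂ L L).isRefl
  rw [← LinearMap.BilinForm.orthogonal_orthogonal hB hrefl
    (LinearMap.range (LieAlgebra.ad ℂ L x))]
  intro y hy
  have hxy : ⁅x, y⁆ = 0 := by
    refine hB.1 _ fun z => ?_
    have h1 : B ⁅x, z⁆ y = 0 := hy _ ⟨z, rfl⟩
    have h2 := LieModule.traceForm_apply_lie_apply' ℂ L L x z y
    rw [LieModule.traceForm_comm]
    have h3 : LieModule.traceForm ℂ L L ⁅x, z⁆ y = 0 := h1
    rw [h3] at h2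
    exact neg_eq_zero.1 h2.symm
  change B y x = 0
  rw [LieModule.traceForm_apply_apply]
  refine (LinearMap.isNilpotent_trace_of_isNilpotent ?_).eq_zero
  have hc : Commute (LieAlgebra.ad ℂ L y) (LieAlgebra.ad ℂ L x) := by
    rw [commute_iff_lie_eq, ← LieHom.map_lie, ← lie_skew, hxy, neg_zero, map_zero]
  exact hc.isNilpotent_mul_left hx

/-! ### Nilpotent orbits of a group with nondegenerate Killing form -/

theorem zero_mem_closure_orbit_of_lie_eq_self (G : LinearAlgebraicGroup n) {h x : G.lieAlgebra}
    (hx : ⁅h, x⁆ = x) : (0 : G.lieAlgebra) ∈ closure[zariskiTopology G.lieAlgebra] (G.orbit x) := by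
  refine mem_closure_zariski_iff.2 fun f hf hvan => ?_
  have hmat : h.1 * x.1 - x.1 * h.1 = x.1 := by
    conv_rhs => rw [← hx]
    rfl
  have hmul : ∀ t : ℂ, f (Complex.exp t • x) = 0 := by
    refine fun t => hvan _ ⟨⟨expGL (t • h.1), expGL_mem G (t • h)⟩, Subtype.ext ?_⟩
    exact exp_mul_mul_exp_neg hmat t
  have hcont : Continuous fun s : ℂ => f (s • x) := by
    -- Continuity is for the Euclidean topology. Vanishing on the orbit is not inherited by the
    -- pieces of `f`, so it is dropped before the induction.
    clear hvan hmul
    rw [polynomialFunctions] at hf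
    induction hf using Algebra.adjoin_induction with
    | mem f hf =>
      obtain ⟨φ, rfl⟩ := hf
      simp only [map_smul]
      fun_prop
    | algebraMap r => exact continuous_const
    | add f g _ _ hf hg => exact hf.add hg
    | mul f g _ _ hf hg => exact hf.mul hg
  -- Every nonzero scalar is an exponential.
  have hzero : ∀ s : ℂ, s ∈ ({0}ᶜ : Set ℂ) → f (s • x) = 0 := fun s hs => by
    rw [← Complex.exp_log hs]
    exact hmul _
  have hcl : IsClosed {s : ℂ | f (s • x) = 0} := isClosed_eq hcont continuous_const
  have := hcl.closure_subset_iff.2 hzero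
  rw [(dense_compl_singleton (0 : ℂ)).closure_eq] at this
  simpa using this (Set.mem_univ 0)

/-! ### Polynomial functions of the inverse matrix -/

theorem entry_mem_polynomialFunctions (i j : Fin n) :
    (fun A : Matrix (Fin n) (Fin n) ℂ => A i j) ∈
      polynomialFunctions (Matrix (Fin n) (Fin n) ℂ) :=
  linear_mem_polynomialFunctions (Matrix.entryLinearMap ℂ ℂ i j)

theorem det_mem_polynomialFunctions {V : Type*} [AddCommGroup V] [Module ℂ V]
    {M : V → Matrix (Fin n) (Fin n) ℂ}
    (hM : ∀ i j, (fun v => M v i j) ∈ polynomialFunctions V) :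
    (fun v => (M v).det) ∈ polynomialFunctions V := by
  have : (fun v => (M v).det) = ∑ σ : Equiv.Perm (Fin n),
      ((Equiv.Perm.sign σ : ℤ) : ℂ) • ∏ i, fun v => M v (σ i) i := by
    ext v
    simp [Matrix.det_apply', Finset.sum_apply, Finset.prod_apply]
  rw [this]
  exact (polynomialFunctions V).sum_mem fun σ _ => (polynomialFunctions V).smul_mem
    ((polynomialFunctions V).prod_mem fun i _ => hM _ _) _

theorem adjugate_entry_mem_polynomialFunctions (i j : Fin n) :
    (fun A : Matrix (Fin n) (Fin n) ℂ => A.adjugate i j) ∈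
      polynomialFunctions (Matrix (Fin n) (Fin n) ℂ) := by
  simp only [Matrix.adjugate_apply]
  refine det_mem_polynomialFunctions fun k l => ?_
  by_cases h : k = j
  · subst h
    simp only [Matrix.updateRow_self]
    exact (polynomialFunctions _).algebraMap_mem (Pi.single (M := fun _ => ℂ) i 1 l)
  · simp only [Matrix.updateRow_ne h]
    exact entry_mem_polynomialFunctions k l

/-- By Cramer's rule the inverse is the adjugate over the determinant, so a power of the determinant
clears denominators. This makes the Zariski closure of a subgroup stable under inversion. -/
theorem exists_polynomialFunction_inv {f : Matrix (Fin n) (Fin n) ℂ → ℂ}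
    (hf : f ∈ polynomialFunctions (Matrix (Fin n) (Fin n) ℂ)) :
    ∃ N : ℕ, ∃ F ∈ polynomialFunctions (Matrix (Fin n) (Fin n) ℂ), ∀ g : GL (Fin n) ℂ,
      F (g : Matrix (Fin n) (Fin n) ℂ) = (g : Matrix (Fin n) (Fin n) ℂ).det ^ N *
        f ((g⁻¹ : GL (Fin n) ℂ) : Matrix (Fin n) (Fin n) ℂ) := by
  have hdet := det_mem_polynomialFunctions (n := n) entry_mem_polynomialFunctions
  induction hf using Algebra.adjoin_induction with
  | mem f hf =>
    obtain ⟨φ, rfl⟩ := hf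
    refine ⟨1, fun A => φ A.adjugate, ?_, fun g => ?_⟩
    · refine comp_mem_polynomialFunctions (fun ψ => ?_) (linear_mem_polynomialFunctions φ)
      have : (fun A : Matrix (Fin n) (Fin n) ℂ => ψ A.adjugate) = ∑ i, ∑ j,
          ψ (Matrix.single i j 1) • fun A : Matrix (Fin n) (Fin n) ℂ => A.adjugate i j := by
        ext A
        conv_lhs => rw [Matrix.matrix_eq_sum_single A.adjugate]
        simp only [map_sum, Finset.sum_apply, Pi.smul_apply, smul_eq_mul]
        refine Finset.sum_congr rfl fun i _ => Finset.sum_congr rfl fun j _ => ?_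
        rw [mul_comm, ← smul_eq_mul, ← map_smul, Matrix.smul_single, smul_eq_mul, mul_one]
      rw [this]
      exact (polynomialFunctions _).sum_mem fun i _ => (polynomialFunctions _).sum_mem fun j _ =>
        (polynomialFunctions _).smul_mem (adjugate_entry_mem_polynomialFunctions i j) _
    · have hg : (g : Matrix (Fin n) (Fin n) ℂ).det ≠ 0 :=
        ((Matrix.isUnit_iff_isUnit_det _).1 g.isUnit).ne_zero
      change φ _ = _ * φ _
      rw [Matrix.coe_units_inv, Matrix.inv_def, map_smul, Ring.inverse_eq_inv', pow_one,
        smul_eq_mul, mul_inv_cancel_left₀ hg]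
  | algebraMap r =>
    exact ⟨0, _, (polynomialFunctions _).algebraMap_mem r, fun g => by simp⟩
  | add f₁ f₂ _ _ h₁ h₂ =>
    obtain ⟨N₁, F₁, hF₁, e₁⟩ := h₁
    obtain ⟨N₂, F₂, hF₂, e₂⟩ := h₂
    refine ⟨N₁ + N₂, _, (polynomialFunctions _).add_mem
      ((polynomialFunctions _).mul_mem ((polynomialFunctions _).pow_mem hdet N₂) hF₁)
      ((polynomialFunctions _).mul_mem ((polynomialFunctions _).pow_mem hdet N₁) hF₂),
      fun g => ?_⟩
    simp only [Pi.add_apply, Pi.mul_apply, Pi.pow_apply, e₁, e₂]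
    ring
  | mul f₁ f₂ _ _ h₁ h₂ =>
    obtain ⟨N₁, F₁, hF₁, e₁⟩ := h₁
    obtain ⟨N₂, F₂, hF₂, e₂⟩ := h₂
    refine ⟨N₁ + N₂, _, (polynomialFunctions _).mul_mem hF₁ hF₂, fun g => ?_⟩
    simp only [Pi.mul_apply, e₁, e₂]
    ring

/-! ### The Zariski closure of a subgroup -/

theorem mem_closure_zariskiGL_iff {S : Set (GL (Fin n) ℂ)} {g : GL (Fin n) ℂ} :
    g ∈ closure[zariskiTopologyGL n] S ↔
      ∀ f ∈ polynomialFunctions (Matrix (Fin n) (Fin n) ℂ),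
        (∀ s ∈ S, f (s : Matrix (Fin n) (Fin n) ℂ) = 0) →
          f (g : Matrix (Fin n) (Fin n) ℂ) = 0 := by
  rw [zariskiTopologyGL, @closure_induced _ _ (zariskiTopology (Matrix (Fin n) (Fin n) ℂ))
    (fun g : GL (Fin n) ℂ => (g : Matrix (Fin n) (Fin n) ℂ)), mem_closure_zariski_iff]
  simp only [Set.forall_mem_image]

/-- The Zariski closure of a subgroup of `GL_n(ℂ)`. -/
def zariskiClosure (E : Subgroup (GL (Fin n) ℂ)) : LinearAlgebraicGroup n where
  carrier := closure[zariskiTopologyGL n] E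
  one_mem' := by
    let _ := zariskiTopologyGL n
    exact subset_closure E.one_mem
  mul_mem' := by
    intro a b ha hb
    rw [mem_closure_zariskiGL_iff] at *
    intro f hf hE
    -- One factor at a time: right translation by `b` reduces `a` to an element `s` of `E`, then
    -- left translation by `s` does the same for `b`.
    refine ha (fun A => f (A * (b : Matrix (Fin n) (Fin n) ℂ)))
      (comp_linear_mem_polynomialFunctions (LinearMap.mulRight ℂ (b : Matrix (Fin n) (Fin n) ℂ)) hf)
      fun s hs => ?_
    refine hb (fun A => f ((s : Matrix (Fin n) (Fin n) ℂ) * A))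
      (comp_linear_mem_polynomialFunctions (LinearMap.mulLeft ℂ (s : Matrix (Fin n) (Fin n) ℂ)) hf)
      fun s' hs' => ?_
    exact hE (s * s') (E.mul_mem hs hs')
  inv_mem' := by
    intro a ha
    change a⁻¹ ∈ closure[zariskiTopologyGL n] _
    rw [mem_closure_zariskiGL_iff] at *
    intro f hf hE
    obtain ⟨N, F, hF, e⟩ := exists_polynomialFunction_inv hf
    have h0 := ha F hF fun s hs => by rw [e, hE _ (E.inv_mem hs), mul_zero]
    rw [e] at h0
    exact (mul_eq_zero.1 h0).resolve_left
      (pow_ne_zero _ ((Matrix.isUnit_iff_isUnit_det _).1 a.isUnit).ne_zero)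
  isClosed_carrier := by
    let _ := zariskiTopologyGL n
    exact isClosed_closure

theorem mem_zariskiClosure_iff (E : Subgroup (GL (Fin n) ℂ)) {g : GL (Fin n) ℂ} :
    g ∈ (zariskiClosure E).toSubgroup ↔
      ∀ f ∈ polynomialFunctions (Matrix (Fin n) (Fin n) ℂ),
        (∀ s ∈ E, f (s : Matrix (Fin n) (Fin n) ℂ) = 0) →
          f (g : Matrix (Fin n) (Fin n) ℂ) = 0 :=
  mem_closure_zariskiGL_iff

theorem le_zariskiClosure (E : Subgroup (GL (Fin n) ℂ)) : E ≤ (zariskiClosure E).toSubgroup :=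
  fun g hg => (mem_zariskiClosure_iff E).2 fun _ _ h => h g hg

theorem zariskiClosure_le {E : Subgroup (GL (Fin n) ℂ)} {G : LinearAlgebraicGroup n}
    (h : E ≤ G.toSubgroup) : (zariskiClosure E).toSubgroup ≤ G.toSubgroup :=
  fun _ hg => G.mem_of_forall fun f hf hG =>
    (mem_zariskiClosure_iff E).1 hg f hf fun s hs => hG s (h hs)

theorem conj_mem_zariskiClosure {E : Subgroup (GL (Fin n) ℂ)} {g : GL (Fin n) ℂ}
    (h : ∀ s ∈ E, g * s * g⁻¹ ∈ E) {a : GL (Fin n) ℂ} (ha : a ∈ (zariskiClosure E).toSubgroup) :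
    g * a * g⁻¹ ∈ (zariskiClosure E).toSubgroup := by
  rw [mem_zariskiClosure_iff] at *
  intro f hf hE
  exact ha (fun A => f ((g : Matrix (Fin n) (Fin n) ℂ) * A * (g⁻¹ : GL (Fin n) ℂ)))
    (comp_linear_mem_polynomialFunctions
      ((LinearMap.mulRight ℂ ((g⁻¹ : GL (Fin n) ℂ) : Matrix (Fin n) (Fin n) ℂ)).comp
        (LinearMap.mulLeft ℂ (g : Matrix (Fin n) (Fin n) ℂ))) hf)
    fun s hs => hE _ (h s hs)

/-- The centralizer in `GL_n(ℂ)` of an invertible matrix. -/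
def centralizerGroup (a : GL (Fin n) ℂ) : LinearAlgebraicGroup n where
  toSubgroup := Subgroup.centralizer {a}
  isClosed_carrier := by
    let _ := zariskiTopologyGL n
    refine isClosed_of_closure_subset fun g hg => ?_
    have hg := mem_closure_zariskiGL_iff.1 hg
    -- Commuting with `a` is a linear condition, tested here against all linear functionals.
    have key : ∀ φ : Module.Dual ℂ (Matrix (Fin n) (Fin n) ℂ),
        φ ((a : Matrix (Fin n) (Fin n) ℂ) * (g : Matrix (Fin n) (Fin n) ℂ)
          - (g : Matrix (Fin n) (Fin n) ℂ) * a) = 0 := by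
      intro φ
      refine hg _ (linear_mem_polynomialFunctions (φ.comp
        (LinearMap.mulLeft ℂ (a : Matrix (Fin n) (Fin n) ℂ)
          - LinearMap.mulRight ℂ (a : Matrix (Fin n) (Fin n) ℂ)))) fun s hs => ?_
      have hs : s * a = a * s := Subgroup.mem_centralizer_singleton_iff.1 hs
      simp only [LinearMap.comp_apply, LinearMap.sub_apply, LinearMap.mulLeft_apply,
        LinearMap.mulRight_apply, ← Units.val_mul, hs, sub_self, map_zero]
    have h0 := (Module.forall_dual_apply_eq_zero_iff ℂ _).1 key
    exact Subgroup.mem_centralizer_singleton_iff.2 (Units.ext (sub_eq_zero.1 h0).symm)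

/-- Centralizers are Zariski closed, so commutation extends to the closure in one variable and then
in the other. -/
theorem mul_comm_of_mem_zariskiClosure {E : Subgroup (GL (Fin n) ℂ)}
    (h : ∀ a ∈ E, ∀ b ∈ E, a * b = b * a) {a b : GL (Fin n) ℂ}
    (ha : a ∈ (zariskiClosure E).toSubgroup) (hb : b ∈ (zariskiClosure E).toSubgroup) :
    a * b = b * a := by
  have h1 : ∀ s ∈ E, b * s = s * b := fun s hs =>
    Subgroup.mem_centralizer_singleton_iff.1 (zariskiClosure_le (G := centralizerGroup s)
      (fun t ht => Subgroup.mem_centralizer_singleton_iff.2 (h t ht s hs)) hb)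
  exact (Subgroup.mem_centralizer_singleton_iff.1 (zariskiClosure_le (G := centralizerGroup b)
      (fun t ht => Subgroup.mem_centralizer_singleton_iff.2 (h1 t ht).symm) ha))

/-- Each point of `E` is joined to `1` inside `E` by a one-parameter group, a continuous image of
`ℂ`; closures of connected sets are connected. -/
theorem isConnected_zariskiClosure {E : Subgroup (GL (Fin n) ℂ)}
    (h : ∀ s ∈ E, ∃ X : Matrix (Fin n) (Fin n) ℂ, s = expGL X ∧ ∀ t : ℂ, expGL (t • X) ∈ E) :
    (zariskiClosure E).IsConnected := by
  let _ := zariskiTopologyGL n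
  have hE : IsPreconnected (E : Set (GL (Fin n) ℂ)) := by
    refine isPreconnected_of_forall 1 fun s hs => ?_
    obtain ⟨X, rfl, hX⟩ := h s hs
    refine ⟨Set.range fun t : ℂ => expGL (t • X), ?_, ⟨0, ?_⟩, ⟨1, ?_⟩, isPreconnected_range ?_⟩
    · rintro _ ⟨t, rfl⟩
      exact hX t
    · simp only [zero_smul, expGL_zero]
    · simp only [one_smul]
    -- Continuity from the Euclidean topology of `ℂ` to the Zariski topology: polynomial functions
    -- along `exp (t X)` are continuous.
    · refine continuous_iff_isClosed.2 fun C hC => ?_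
      obtain ⟨T, hT, rfl⟩ := (@isClosed_induced_iff _ _
        (zariskiTopology (Matrix (Fin n) (Fin n) ℂ)) _ _).1 hC
      obtain ⟨F, hF, rfl⟩ := isClosed_zariski_iff.1 hT
      have : (fun t : ℂ => expGL (t • X)) ⁻¹' ((fun g : GL (Fin n) ℂ =>
          (g : Matrix (Fin n) (Fin n) ℂ)) ⁻¹' {v | ∀ f ∈ F, f v = 0})
          = ⋂ f ∈ F, {t : ℂ | f (NormedSpace.exp (t • X)) = 0} := by
        ext t
        simp [coe_expGL]
      rw [this]
      refine isClosed_biInter fun f hf => ?_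
      obtain ⟨p, rfl⟩ := exists_evalPoly_eq (hF hf)
      exact isClosed_eq (continuous_iff_continuousAt.2 fun t =>
        (hasDerivAt_evalPoly_exp X p t).continuousAt) continuous_const
  exact IsConnected.closure ⟨⟨1, E.one_mem⟩, hE⟩

/-! ### The radical of the Lie algebra of a semisimple group -/

/-- The pullback of the radical along `e.symm` is an ideal that embeds in the radical, hence is
solvable and contained in it. -/
theorem map_mem_radical {L : Type*} [LieRing L] [LieAlgebra ℂ L] [IsNoetherian ℂ L]
    (e : L ≃ₗ⁅ℂ⁆ L) {x : L} (hx : x ∈ LieAlgebra.radical ℂ L) :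
    e x ∈ LieAlgebra.radical ℂ L := by
  let J := (LieAlgebra.radical ℂ L).comap e.symm.toLieHom
  let ψ : J →ₗ⁅ℂ⁆ LieAlgebra.radical ℂ L :=
    { toFun := fun y => ⟨e.symm y.1, y.2⟩
      map_add' := fun y z => Subtype.ext (map_add e.symm y.1 z.1)
      map_smul' := fun c y => Subtype.ext (map_smul e.symm c y.1)
      map_lie' := fun {y z} => Subtype.ext (LieEquiv.map_lie e.symm y.1 z.1) }
  have hψ : Function.Injective ψ := fun y z h =>
    Subtype.ext (e.symm.injective (congrArg Subtype.val h))
  have hJ : LieAlgebra.IsSolvable J := hψ.lieAlgebra_isSolvable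
  refine (LieAlgebra.LieIdeal.solvable_iff_le_radical ℂ L J).1 hJ ?_
  change e.symm (e x) ∈ LieAlgebra.radical ℂ L
  rwa [e.symm_apply_apply]

theorem map_derivedSeriesOfIdeal_le {L : Type*} [LieRing L] [LieAlgebra ℂ L]
    (e : L →ₗ⁅ℂ⁆ L) {I : LieIdeal ℂ L} (hI : I.map e ≤ I) (k : ℕ) :
    (LieAlgebra.derivedSeriesOfIdeal ℂ L k I).map e
      ≤ LieAlgebra.derivedSeriesOfIdeal ℂ L k I := by
  induction k with
  | zero => exact hI
  | succ k ih =>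
    rw [LieAlgebra.derivedSeriesOfIdeal_succ]
    exact (LieIdeal.map_bracket_le e).trans (LieSubmodule.mono_lie ih ih)

theorem map_mem_derivedAbelianOfIdeal_radical {L : Type*} [LieRing L] [LieAlgebra ℂ L]
    [IsNoetherian ℂ L] (e : L ≃ₗ⁅ℂ⁆ L) {x : L}
    (hx : x ∈ LieAlgebra.derivedAbelianOfIdeal (LieAlgebra.radical ℂ L)) :
    e x ∈ LieAlgebra.derivedAbelianOfIdeal (LieAlgebra.radical ℂ L) := by
  unfold LieAlgebra.derivedAbelianOfIdeal at *
  -- Split on the derived length: for length `0` the ideal is `⊥`, for `k + 1` it is the `k`-th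
  -- derived term.
  split at hx
  · rw [LieSubmodule.mem_bot] at hx ⊢
    rw [hx, map_zero]
  · refine map_derivedSeriesOfIdeal_le e.toLieHom (LieIdeal.map_le_iff_le_comap.2 fun y hy => ?_) _
      (LieIdeal.mem_map hx)
    exact map_mem_radical e hy

/-- The subgroup `exp(𝔞)` for a commutative ideal `𝔞` of `𝔤`. -/
def expSubgroup (G : LinearAlgebraicGroup n) (I : LieIdeal ℂ G.lieAlgebra)
    (hI : ∀ x ∈ I, ∀ y ∈ I, Commute x.1 y.1) : Subgroup (GL (Fin n) ℂ) where
  carrier := {g | ∃ x ∈ I, g = expGL x.1}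
  one_mem' := ⟨0, I.zero_mem, expGL_zero.symm⟩
  mul_mem' := by
    rintro _ _ ⟨x, hx, rfl⟩ ⟨y, hy, rfl⟩
    exact ⟨x + y, I.add_mem hx hy, (expGL_add (hI x hx y hy)).symm⟩
  inv_mem' := by
    rintro _ ⟨x, hx, rfl⟩
    exact ⟨-x, I.neg_mem hx, (expGL_neg x.1).symm⟩

/-- The Zariski closure of `exp I` is a connected commutative closed normal subgroup of `G`, hence
trivial; differentiating `exp (t x) = 1` at `0` gives `x = 0`. -/
theorem LinearAlgebraicGroup.IsConnectedSemisimple.eq_bot_of_isLieAbelian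
    {G : LinearAlgebraicGroup n} (hG : G.IsConnectedSemisimple) (I : LieIdeal ℂ G.lieAlgebra)
    (hab : IsLieAbelian I) (hAd : ∀ (g : G.toSubgroup), ∀ x ∈ I, G.Ad g x ∈ I) : I = ⊥ := by
  have hI : ∀ x ∈ I, ∀ y ∈ I, Commute x.1 y.1 := by
    intro x hx y hy
    have h : ⁅(⟨x, hx⟩ : I), (⟨y, hy⟩ : I)⁆ = 0 := trivial_lie_zero _ _ _ _
    have h2 : x.1 * y.1 - y.1 * x.1 = 0 := congrArg (fun z : I => z.1.1) h
    exact sub_eq_zero.1 h2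
  let E := expSubgroup G I hI
  have hEG : E ≤ G.toSubgroup := by
    rintro _ ⟨x, -, rfl⟩
    exact expGL_mem G x
  have hcomm : ∀ a ∈ E, ∀ b ∈ E, a * b = b * a := by
    rintro _ ⟨x, hx, rfl⟩ _ ⟨y, hy, rfl⟩
    rw [← expGL_add (hI x hx y hy), ← expGL_add (hI y hy x hx), add_comm]
  have hbot := hG.radical_trivial (zariskiClosure E) (zariskiClosure_le hEG)
    ⟨fun a ha g => by
      rw [Subgroup.mem_subgroupOf] at ha ⊢
      refine conj_mem_zariskiClosure (g := g.1) ?_ ha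
      rintro _ ⟨x, hx, rfl⟩
      refine ⟨G.Ad g x, hAd g x hx, ?_⟩
      rw [coe_Ad_apply, expGL_conj]⟩
    (isConnected_zariskiClosure (by
      rintro _ ⟨x, hx, rfl⟩
      exact ⟨x.1, rfl, fun t => ⟨t • x, I.smul_mem t hx, rfl⟩⟩))
    (Group.isSolvable_of_comm fun a b =>
      Subtype.ext (mul_comm_of_mem_zariskiClosure hcomm a.2 b.2))
  rw [LieSubmodule.eq_bot_iff]
  refine fun x hx => Subtype.ext (eq_zero_of_expGL_smul_eq_one fun t => ?_)
  have : expGL (t • x.1) ∈ (zariskiClosure E).toSubgroup :=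
    le_zariskiClosure E ⟨t • x, I.smul_mem t hx, rfl⟩
  rw [hbot] at this
  exact Subgroup.mem_bot.1 this

/-- The last nonzero derived term of the radical is abelian and stable under every automorphism of
`𝔤`, in particular under `Ad`. -/
theorem LinearAlgebraicGroup.IsConnectedSemisimple.hasTrivialRadical
    {G : LinearAlgebraicGroup n} (hG : G.IsConnectedSemisimple) :
    LieAlgebra.HasTrivialRadical ℂ G.lieAlgebra :=
  ⟨(LieAlgebra.abelian_of_solvable_ideal_eq_bot_iff _).1 (hG.eq_bot_of_isLieAbelian _
    (LieAlgebra.abelian_derivedAbelianOfIdeal _)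
    fun g _ hx => map_mem_derivedAbelianOfIdeal_radical (G.AdEquiv g) hx)⟩

theorem LinearAlgebraicGroup.IsConnectedSemisimple.zeroOrbit_le {G : LinearAlgebraicGroup n}
    (hG : G.IsConnectedSemisimple) {O : AdjointOrbit G} (hO : O ∈ nilpotentOrbits G) :
    zeroOrbit G ≤ O := by
  -- Cartan's criterion enters by instance inference, giving the nondegenerate Killing form needed
  -- below.
  have := hG.hasTrivialRadical
  obtain ⟨x, hx⟩ := O.2
  obtain ⟨h, hh⟩ :=
    exists_lie_eq_self_of_isNilpotent_ad ((orbit_mem_nilpotentOrbits_iff G O hx).1 hO)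
  rintro _ rfl
  rw [hx]
  exact zero_mem_closure_orbit_of_lie_eq_self G hh

/-! ### Paths of comparisons -/

theorem ComparisonPath.of_le {P : Type*} [PartialOrder P] {Q : Set P} {p q r : P} (hp : p ∈ Q)
    (hq : q ∈ Q) (hr : r ∈ Q) (hrp : r ≤ p) (hrq : r ≤ q) : ComparisonPath Q p q := by
  refine ⟨2, ![p, r, q], ?_, rfl, rfl, ?_⟩
  · intro j
    fin_cases j <;> assumption
  · intro j
    fin_cases j
    · exact Or.inr hrp
    · exact Or.inl hrq

theorem ComparisonPath.mem_of_mem {P : Type*} [PartialOrder P] {Q S : Set P}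
    (hS : ∀ p q, p ≤ q → (p ∈ S ↔ q ∈ S)) {p q : P} (h : ComparisonPath Q p q) (hp : p ∈ S) :
    q ∈ S := by
  obtain ⟨k, r, -, rfl, rfl, hr⟩ := h
  have : ∀ j, r j ∈ S := by
    intro j
    induction j using Fin.induction with
    | zero => exact hp
    | succ j ih =>
      rcases hr j with h | h
      · exact (hS _ _ h).1 ih
      · exact (hS _ _ h).2 ih
  exact this _

end AdjointOrbits

end

/-! ### The component of nilpotent orbits -/

theorem mainTheorem8 (n : ℕ) (G : AdjointOrbits.LinearAlgebraicGroup n)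
    (hG : G.IsConnectedSemisimple) :
    AdjointOrbits.IsPosetComponent (AdjointOrbits.nilpotentOrbits G) ∧
    AdjointOrbits.zeroOrbit G ∈ AdjointOrbits.nilpotentOrbits G ∧
    (∀ O ∈ AdjointOrbits.nilpotentOrbits G,
      AdjointOrbits.ComparisonPath (AdjointOrbits.nilpotentOrbits G)
        (AdjointOrbits.zeroOrbit G) O) ∧
    (∀ O ∈ AdjointOrbits.nilpotentOrbits G, ∀ Θ : AdjointOrbits.AdjointOrbit G,
      (Θ ≤ O ∨ O ≤ Θ) → Θ ∈ AdjointOrbits.nilpotentOrbits G) := by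
  have h0 := AdjointOrbits.zeroOrbit_mem_nilpotentOrbits G
  refine ⟨⟨fun p hp q hq => AdjointOrbits.ComparisonPath.of_le hp hq h0 (hG.zeroOrbit_le hp)
    (hG.zeroOrbit_le hq), fun Q hQ hle q hq => ?_⟩, h0,
    fun O hO => AdjointOrbits.ComparisonPath.of_le h0 hO h0 le_rfl (hG.zeroOrbit_le hO),
    fun O hO Θ h => ?_⟩
  -- Maximality: a larger connected `Q` joins `{0}` to `q`, and no comparison leaves the nilpotent
  -- orbits, even if the path runs through `Q`.
  · exact (hQ _ (hle h0) q hq).mem_of_mem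
      (fun _ _ => AdjointOrbits.mem_nilpotentOrbits_iff_of_le G) h0
  · rcases h with h | h
    · exact (AdjointOrbits.mem_nilpotentOrbits_iff_of_le G h).2 hO
    · exact (AdjointOrbits.mem_nilpotentOrbits_iff_of_le G h).1 hO
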